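/- **Conventions.** A quantale here is a complete lattice $A$ (with least element $0$ and greatest element $1$) together with a commutative associative multiplication that distributes over arbitrary joins and has $1$ as unit. Let $K(A)$ be the set of compact elements of $A$. $A$ is *coherent* if every element is a join of compact elements, $1\in K(A)$, and $K(A)$ is closed under multiplication. Write $a^{\perp}=\bigvee\{x\in A : ax=0\}$, and let $B(A)$ be the set of complemented elements of $A$. An element $p<1$ is *$m$-prime* if $ab\le p$ implies $a\le p$ or $b\le p$; $\mathrm{Spec}(A)$ is the set of $m$-prime elements and $\mathrm{Min}(A)$ the set of its minimal elements. $A$ is *semiprime* if $\bigwedge \mathrm{Spec}(A)=0$. For $a\in A$ put $V(a)=\{p\in \mathrm{Spec}(A): a\le p\}$. $\mathrm{Min}_Z(A)$ is $\mathrm{Min}(A)$ with the topology induced by the topology on $\mathrm{Spec}(A)$ whose closed sets are the $V(a)$, $a\in A$; $\mathrm{Spec}_F(A)$ is $\mathrm{Spec}(A)$ with the flat topology, which has the sets $V(c)$, $c\in K(A)$, as a basis of open sets. An element $a$ is *pure* if $a\vee c^{\perp}=1$ for all $c\in K(A)$ with $c\le a$. $A$ is a *$PP$-quantale* if $c^{\perp}\in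 B(A)$ for all $c\in K(A)$; a *$PF$-quantale* if $c^{\perp}$ is pure for all $c\in K(A)$; an *$mp$-quantale* if for every $p\in\mathrm{Spec}(A)$ there is a unique $q\in \mathrm{Min}(A)$ with $q\le p$. The *reticulation* $L(A)$ of a coherent quantale $A$ is the bounded distributive lattice, unique up to isomorphism, for which there is a surjection $\lambda:K(A)\to L(A)$ with $\lambda(a\vee b)\le\lambda(a)\vee\lambda(b)$, $\lambda(ab)=\lambda(a)\wedge\lambda(b)$, and $\lambda(a)\le\lambda(b)$ iff $a^n\le b$ for some integer $n\ge 1$. For a bounded distributive lattice $L$, $\mathrm{Min}_{Id,Z}(L)$ is the set of minimal prime ideals of $L$ with the topology induced by the Stone topology on the set of prime ideals (basis of open sets $\{P : x\notin P\}$, $x\in L$). $L$ is a *Stone lattice* if for every $x\in L$ there is a complemented $e\in L$ with $\{y\in L: x\wedge y=0\}=\{y\in L : y\le e\}$; $L$ is *conormal* if $x\wedge y=0$ implies that there are $u,v\in L$ with $x\wedge u=y\wedge v=0$ and $u\vee v=1$. A *Boolean space* is a compact, Hausdorff, totally disconnected space; a space is *normal* if disjoint closed sets have disjoint open neighbourhoods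 (no separation axiom for points is required). **Theorem.** Let $A$ be a semiprime coherent quantale. The following are equivalent: 1. $A$ is a $PP$-quantale; 2. $L(A)$ is a Stone lattice; 3. $L(A)$ is conormal and $\mathrm{Min}_{Id,Z}(L(A))$ is compact; 4. $A$ is a $PF$-quantale and $\mathrm{Min}_Z(A)$ is compact; 5. $A$ is a $PF$-quantale and $\mathrm{Min}_Z(A)$ is a Boolean space; 6. $A$ is an $mp$-quantale and $\mathrm{Min}_Z(A)$ is a Boolean space; 7. $\mathrm{Spec}_F(A)$ is a normal space and $\mathrm{Min}_Z(A)$ is a Boolean space. -/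

import Mathlib

universe u v

namespace CohQuantale

section QuantaleNotions

variable (A : Type u) [CommMonoid A] [CompleteLattice A] [IsQuantale A]

/-- A coherent (integral, commutative) quantale: the unit of the multiplication is the top
element, every element is a join of compact elements, the top element is compact, and the compact
elements are closed under multiplication. -/
class IsCoherent : Prop extends IsCompactlyGenerated A where
  one_eq_top : (1 : A) = ⊤
  isCompact_top : IsCompactElement (⊤ : A)
  isCompact_mul : ∀ a b : A, IsCompactElement a → IsCompactElement b → IsCompactElement (a * b)

/-- The set `K(A)` of compact elements, as a type. -/
def K : Type u := {c : A // IsCompactElement c}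

variable {A}

/-- The `m`-prime elements. -/
def IsMPrime (p : A) : Prop :=
  p < ⊤ ∧ ∀ a b : A, a * b ≤ p → a ≤ p ∨ b ≤ p

/-- The minimal `m`-prime elements. -/
def IsMinimalMPrime (p : A) : Prop := Minimal IsMPrime p

/-- The radical `ρ(a)`: the meet of all `m`-prime elements above `a`. -/
def radical (a : A) : A := sInf {p : A | IsMPrime p ∧ a ≤ p}

/-- The annihilator `a^⊥`: the join of all `x` with `a x = 0`. -/
def perp (a : A) : A := sSup {x : A | a * x = ⊥}

/-- Pure elements. -/
def IsPure (a : A) : Prop :=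
  ∀ c : A, IsCompactElement c → c ≤ a → a ⊔ perp c = ⊤

variable (A)

def IsSemiprime : Prop := radical (⊥ : A) = ⊥

/-- `PP`-quantales: `c^⊥` is complemented for every compact `c`. -/
def IsPP : Prop := ∀ c : A, IsCompactElement c → IsComplemented (perp c)

/-- `PF`-quantales: `c^⊥` is pure for every compact `c`. -/
def IsPF : Prop := ∀ c : A, IsCompactElement c → IsPure (perp c)

/-- `mp`-quantales: below every `m`-prime element there is exactly one minimal `m`-prime
element. -/
def IsMP : Prop := ∀ p : A, IsMPrime p → ∃! q : A, IsMinimalMPrime q ∧ q ≤ p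

end QuantaleNotions

section Auxiliary

variable {A : Type u} [CommMonoid A] [CompleteLattice A] [IsQuantale A] [IsCoherent A]

theorem le_one' (a : A) : a ≤ 1 := by
  rw [IsCoherent.one_eq_top]; exact le_top

theorem mul_le_left' (a b : A) : a * b ≤ a := by
  calc a * b ≤ a * 1 := mul_le_mul_right (le_one' b) a
    _ = a := mul_one a

theorem mul_le_right' (a b : A) : a * b ≤ b := by
  rw [mul_comm]; exact mul_le_left' b a

theorem sup_pow_le (a b : A) (n m : ℕ) : (a ⊔ b) ^ (n + m) ≤ a ^ n ⊔ b ^ m := by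
  induction n generalizing m with
  | zero => rw [pow_zero]; exact (le_one' _).trans le_sup_left
  | succ n ihn =>
    induction m with
    | zero => rw [pow_zero]; exact (le_one' _).trans le_sup_right
    | succ m ihm =>
      have h1 : (a ⊔ b) ^ (n + (m + 1)) * a ≤ a ^ (n + 1) ⊔ b ^ (m + 1) := by
        refine (mul_le_mul_left (ihn (m + 1)) a).trans ?_
        rw [Quantale.sup_mul_distrib, ← pow_succ]
        exact sup_le_sup le_rfl (mul_le_left' _ _)
      have h2 : (a ⊔ b) ^ (n + 1 + m) * b ≤ a ^ (n + 1) ⊔ b ^ (m + 1) := by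
        refine (mul_le_mul_left ihm b).trans ?_
        rw [Quantale.sup_mul_distrib, ← pow_succ]
        exact sup_le_sup (mul_le_left' _ _) le_rfl
      have e : (a ⊔ b) ^ (n + 1 + (m + 1)) = (a ⊔ b) ^ (n + (m + 1)) * (a ⊔ b) := by
        rw [← pow_succ]; congr 1; omega
      have e2 : n + (m + 1) = n + 1 + m := by omega
      rw [e, Quantale.mul_sup_distrib]
      exact sup_le h1 (e2 ▸ h2)

theorem isCompact_bot : IsCompactElement (⊥ : A) := by
  simpa using CompleteLattice.isCompactElement_finsetSup (α := A) (f := id) ∅ (by simp)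

theorem isCompact_sup {a b : A} (ha : IsCompactElement a) (hb : IsCompactElement b) :
    IsCompactElement (a ⊔ b) := by
  classical
  simpa using CompleteLattice.isCompactElement_finsetSup (α := A) (f := id) {a, b} (by simp [ha, hb])

end Auxiliary

section Spectra

variable (A : Type u) [CommMonoid A] [CompleteLattice A] [IsQuantale A]

/-- The set `Spec(A)` of `m`-prime elements, carrying the spectral (Zariski) topology. -/
def SpecZ : Type u := {p : A // IsMPrime p}

/-- The set `Spec(A)` of `m`-prime elements, carrying the flat topology. -/
def SpecF : Type u := {p : A // IsMPrime p}

/-- The topology whose closed sets are exactly the sets `V(a) = {p | a ≤ p}` with `a ∈ A`. -/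
instance [IsCoherent A] : TopologicalSpace (SpecZ A) :=
  TopologicalSpace.ofClosed (Set.range fun a : A => {p : SpecZ A | a ≤ p.1})
    ⟨⊤, by
      ext p
      simp only [Set.mem_ofPred_eq, Set.mem_empty_iff_false, iff_false]
      exact fun h => not_lt_of_ge h p.2.1⟩
    (by
      intro S hS
      refine ⟨sSup {a : A | {p : SpecZ A | a ≤ p.1} ∈ S}, ?_⟩
      ext p
      simp only [Set.mem_ofPred_eq, sSup_le_iff, Set.mem_sInter]
      constructor
      · intro h t ht
        obtain ⟨a, rfl⟩ := hS ht
        exact h a ht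
      · intro h a ha
        exact h _ ha)
    (by
      rintro _ ⟨a, rfl⟩ _ ⟨b, rfl⟩
      refine ⟨a * b, ?_⟩
      ext p
      simp only [Set.mem_ofPred_eq, Set.mem_union]
      constructor
      · exact p.2.2 a b
      · rintro (h | h)
        · exact (mul_le_left' a b).trans h
        · exact (mul_le_right' a b).trans h)

/-- The flat topology: the sets `V(c) = {p | c ≤ p}` with `c` compact form a basis of open sets
(they are closed under finite intersections, as `V(c) ∩ V(d) = V(c ⊔ d)` and
`V(⊥)` is everything). -/
instance : TopologicalSpace (SpecF A) :=
  TopologicalSpace.generateFrom {U | ∃ c : A, IsCompactElement c ∧ U = {p : SpecF A | c ≤ p.1}}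

/-- The set `Min(A)` of minimal `m`-prime elements, as a subspace of `SpecZ A`. -/
abbrev MinZ : Type u := {p : SpecZ A // IsMinimalMPrime p.1}

end Spectra

/-- Boolean (Stone) spaces: compact, Hausdorff and totally disconnected. -/
def IsBooleanSpace (X : Type u) [TopologicalSpace X] : Prop :=
  CompactSpace X ∧ T2Space X ∧ TotallyDisconnectedSpace X

section Lattices

variable (L : Type u) [DistribLattice L] [BoundedOrder L]

/-- Stone lattices: the annihilator `{y | x ⊓ y = 0}` of every element `x` is the principal ideal
generated by a complemented element. -/
def IsStoneLattice : Prop :=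
  ∀ x : L, ∃ e : L, IsComplemented e ∧ {y : L | x ⊓ y = ⊥} = Set.Iic e

/-- Conormal lattices. -/
def IsConormalLattice : Prop :=
  ∀ x y : L, x ⊓ y = ⊥ → ∃ s t : L, x ⊓ s = ⊥ ∧ y ⊓ t = ⊥ ∧ s ⊔ t = ⊤

/-- The set of prime ideals of a bounded distributive lattice, carrying the Stone topology. -/
def SpecIdZ : Type u := {P : Order.Ideal L // P.IsPrime}

/-- The Stone topology: the sets `{P | x ∉ P}` with `x ∈ L` form a basis of open sets. -/
instance : TopologicalSpace (SpecIdZ L) :=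
  TopologicalSpace.generateFrom {U | ∃ x : L, U = {P : SpecIdZ L | x ∉ P.1}}

/-- The set of minimal prime ideals, as a subspace of `SpecIdZ L`. -/
abbrev MinIdZ : Type u :=
  {P : SpecIdZ L // Minimal (fun I : Order.Ideal L => I.IsPrime) P.1}

end Lattices

section Reticulation

variable (A : Type u) [CommMonoid A] [CompleteLattice A] [IsQuantale A] [IsCoherent A]

/-- The preorder on `K(A)` with `a ≼ b` iff `a ^ n ≤ b` for some `n ≥ 1`. -/
def ReticLE (a b : K A) : Prop := ∃ n : ℕ, 1 ≤ n ∧ a.1 ^ n ≤ b.1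

variable {A}

theorem ReticLE.of_le {a b : K A} (h : a.1 ≤ b.1) : ReticLE A a b :=
  ⟨1, le_rfl, by rwa [pow_one]⟩

theorem ReticLE.trans {a b c : K A} : ReticLE A a b → ReticLE A b c → ReticLE A a c := by
  rintro ⟨n, hn, h⟩ ⟨m, hm, h'⟩
  refine ⟨n * m, Nat.mul_pos hn hm, ?_⟩
  rw [pow_mul]
  exact (pow_le_pow_left' h m).trans h'

/-- The binary join on `K(A)`. -/
def K.sup (a b : K A) : K A := ⟨a.1 ⊔ b.1, isCompact_sup a.2 b.2⟩

/-- The multiplication on `K(A)`. -/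
def K.mul (a b : K A) : K A := ⟨a.1 * b.1, IsCoherent.isCompact_mul _ _ a.2 b.2⟩

theorem ReticLE.sup_le {a b c : K A} : ReticLE A a c → ReticLE A b c → ReticLE A (a.sup b) c := by
  rintro ⟨n, hn, h⟩ ⟨m, _, h'⟩
  exact ⟨n + m, by omega, (sup_pow_le a.1 b.1 n m).trans (_root_.sup_le h h')⟩

theorem ReticLE.le_mul {a b c : K A} : ReticLE A a b → ReticLE A a c → ReticLE A a (b.mul c) := by
  rintro ⟨n, hn, h⟩ ⟨m, _, h'⟩
  refine ⟨n + m, by omega, ?_⟩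
  rw [pow_add]
  exact mul_le_mul' h h'

variable (A)

/-- Two compact elements are identified when each lies above a positive power of the other. -/
def reticSetoid : Setoid (K A) where
  r a b := ReticLE A a b ∧ ReticLE A b a
  iseqv :=
    ⟨fun _ => ⟨.of_le le_rfl, .of_le le_rfl⟩, fun h => ⟨h.2, h.1⟩,
      fun h h' => ⟨h.1.trans h'.1, h'.2.trans h.2⟩⟩

/-- The reticulation `L(A)` of a coherent quantale. -/
def Retic : Type u := Quotient (reticSetoid A)

variable {A}

/-- The canonical map `λ : K(A) → L(A)`. -/
def lam (c : K A) : Retic A := Quotient.mk (reticSetoid A) c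

instance : LE (Retic A) where
  le := Quotient.lift₂ (ReticLE A) (fun _ _ _ _ h h' => propext
    ⟨fun k => (h.2.trans k).trans h'.1, fun k => (h.1.trans k).trans h'.2⟩)

theorem lam_le_lam {a b : K A} : lam a ≤ lam b ↔ ReticLE A a b := Iff.rfl

instance : PartialOrder (Retic A) where
  le_refl x := Quotient.inductionOn x fun _ => ReticLE.of_le le_rfl
  le_trans x y z := Quotient.inductionOn₃ x y z fun _ _ _ h h' => ReticLE.trans h h'
  le_antisymm x y := Quotient.inductionOn₂ x y fun _ _ h h' => Quotient.sound ⟨h, h'⟩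

instance : Lattice (Retic A) where
  sup := Quotient.map₂ K.sup (fun _ _ h _ _ h' =>
    ⟨.sup_le (h.1.trans (.of_le le_sup_left)) (h'.1.trans (.of_le le_sup_right)),
      .sup_le (h.2.trans (.of_le le_sup_left)) (h'.2.trans (.of_le le_sup_right))⟩)
  le_sup_left x y := Quotient.inductionOn₂ x y fun _ _ => ReticLE.of_le le_sup_left
  le_sup_right x y := Quotient.inductionOn₂ x y fun _ _ => ReticLE.of_le le_sup_right
  sup_le x y z := Quotient.inductionOn₃ x y z fun _ _ _ h h' => ReticLE.sup_le h h'
  inf := Quotient.map₂ K.mul (fun _ _ h _ _ h' =>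
    ⟨.le_mul (.trans (.of_le (mul_le_left' _ _)) h.1) (.trans (.of_le (mul_le_right' _ _)) h'.1),
      .le_mul (.trans (.of_le (mul_le_left' _ _)) h.2)
        (.trans (.of_le (mul_le_right' _ _)) h'.2)⟩)
  inf_le_left x y := Quotient.inductionOn₂ x y fun _ _ => ReticLE.of_le (mul_le_left' _ _)
  inf_le_right x y := Quotient.inductionOn₂ x y fun _ _ => ReticLE.of_le (mul_le_right' _ _)
  le_inf x y z := Quotient.inductionOn₃ x y z fun _ _ _ h h' => ReticLE.le_mul h h'

theorem lam_sup (a b : K A) : lam (a.sup b) = lam a ⊔ lam b := rfl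

theorem lam_mul (a b : K A) : lam (a.mul b) = lam a ⊓ lam b := rfl

instance : DistribLattice (Retic A) where
  le_sup_inf x y z := Quotient.inductionOn₃ x y z fun a b c => ReticLE.of_le (by
    change (a.1 ⊔ b.1) * (a.1 ⊔ c.1) ≤ a.1 ⊔ b.1 * c.1
    rw [Quantale.mul_sup_distrib, Quantale.sup_mul_distrib, Quantale.sup_mul_distrib]
    exact _root_.sup_le (_root_.sup_le ((mul_le_left' _ _).trans le_sup_left)
        ((mul_le_right' _ _).trans le_sup_left))
      (_root_.sup_le ((mul_le_left' _ _).trans le_sup_left) le_sup_right))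

instance : BoundedOrder (Retic A) where
  top := lam ⟨⊤, IsCoherent.isCompact_top⟩
  le_top x := Quotient.inductionOn x fun _ => ReticLE.of_le le_top
  bot := lam ⟨⊥, isCompact_bot⟩
  bot_le x := Quotient.inductionOn x fun _ => ReticLE.of_le bot_le

/-- The axiomatic notion: a reticulation of `A` is a bounded distributive lattice `L` with a
surjection `f : K(A) → L` having the following three properties. -/
structure IsReticulation {L : Type v} [DistribLattice L] [BoundedOrder L] (f : K A → L) :
    Prop where
  surjective : Function.Surjective f
  map_sup_le : ∀ a b : K A, f (a.sup b) ≤ f a ⊔ f b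
  map_mul : ∀ a b : K A, f (a.mul b) = f a ⊓ f b
  map_le_map_iff : ∀ a b : K A, f a ≤ f b ↔ ∃ n : ℕ, 1 ≤ n ∧ a.1 ^ n ≤ b.1

/-- `L(A)` with `λ` is a reticulation of `A`. -/
theorem isReticulation_lam : IsReticulation (lam : K A → Retic A) where
  surjective := Quotient.mk_surjective
  map_sup_le _ _ := le_rfl
  map_mul _ _ := rfl
  map_le_map_iff _ _ := Iff.rfl

/-- Reticulations are unique: every reticulation is isomorphic to `L(A)`, compatibly with the
maps from `K(A)`. -/
theorem IsReticulation.exists_orderIso {L : Type v} [DistribLattice L] [BoundedOrder L]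
    {f : K A → L} (hf : IsReticulation f) : ∃ e : Retic A ≃o L, ∀ c : K A, e (lam c) = f c := by
  have hle : ∀ a b : K A, f a ≤ f b ↔ lam a ≤ lam b := fun a b => hf.map_le_map_iff a b
  let g : Retic A → L := Quotient.lift f fun a b h =>
    le_antisymm ((hle a b).2 h.1) ((hle b a).2 h.2)
  have hg : ∀ x y : Retic A, g x ≤ g y ↔ x ≤ y := fun x y =>
    Quotient.inductionOn₂ x y fun a b => hle a b
  have hs : Function.Surjective g := fun y => by
    obtain ⟨c, hc⟩ := hf.surjective y
    exact ⟨lam c, hc⟩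
  exact ⟨RelIso.ofSurjective (OrderEmbedding.ofMapLEIff g hg) hs, fun _ => rfl⟩

end Reticulation

end CohQuantale

/-!
The reticulation carries the whole prime structure of `A`: it turns products into meets, and
`Spec(A)` into the prime ideals of `L(A)` homeomorphically and monotonically, so the statements
about `L(A)` translate into statements about `A`. On the side of `A`, the key fact is that in a
semiprime quantale every `m`-prime element above `c^⊥` has a minimal one below it that is not above
`c`. Hence a minimal `m`-prime element lies above exactly one of `c` and `c^⊥`, the sets `V(c)` are
clopen in `Min(A)`, and `PF` is the same as `mp`. If `Min(A)` is compact, then `V(c) ∩ Min(A)` is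
already missed by a single `V(d)` with `d` compact and `cd = 0`, and in a `PF`-quantale `d^⊥` is
then a complement of `c^⊥`. Conversely, in a `PP`-quantale the map sending an `m`-prime element to a
minimal one below it is a retraction of the spectrum onto `Min(A)`, continuous for both the Zariski
and the flat topology; so `Min(A)` inherits compactness from the former, and the latter inherits
normality from `Min(A)`.
-/

namespace CohQuantale

section CompactlyGenerated

variable {α : Type u} [CompleteLattice α] [IsCompactlyGenerated α]

theorem exists_isCompactElement_le_not_le {a b : α} (h : ¬ a ≤ b) :
    ∃ c, IsCompactElement c ∧ c ≤ a ∧ ¬ c ≤ b := by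
  by_contra! h'
  exact h (le_iff_compact_le_imp.2 h')

theorem exists_isCompactElement_le_sup {a b c : α} (hc : IsCompactElement c) (h : c ≤ a ⊔ b) :
    ∃ s, IsCompactElement s ∧ s ≤ a ∧ c ≤ s ⊔ b := by
  classical
  obtain ⟨t, ht, hct⟩ :=
    (CompleteLattice.isCompactElement_iff_exists_le_sSup_of_le_sSup α c).1 hc
      (insert b {k | IsCompactElement k ∧ k ≤ a})
      (by rwa [sSup_insert, sSup_compact_le_eq, sup_comm])
  have hmem : ∀ k ∈ t.erase b, IsCompactElement k ∧ k ≤ a := fun k hk =>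
    (ht (Finset.mem_of_mem_erase hk)).resolve_left (Finset.ne_of_mem_erase hk)
  refine ⟨(t.erase b).sup id,
    CompleteLattice.isCompactElement_finsetSup _ fun k hk => (hmem k hk).1,
    Finset.sup_le fun k hk => (hmem k hk).2, hct.trans (Finset.sup_le fun k hk => ?_)⟩
  rcases eq_or_ne k b with rfl | hkb
  · exact le_sup_right
  · exact (Finset.le_sup (f := id) (Finset.mem_erase.2 ⟨hkb, hk⟩)).trans le_sup_left

end CompactlyGenerated

section MPrime

variable {A : Type u} [CommMonoid A] [CompleteLattice A]

theorem IsMPrime.mul_not_le {p a b : A} (hp : IsMPrime p) (ha : ¬ a ≤ p) (hb : ¬ b ≤ p) :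
    ¬ a * b ≤ p := fun h => (hp.2 a b h).elim ha hb

theorem isMPrime_sInf_of_isChain {s : Set A} (hs : ∀ p ∈ s, IsMPrime p) (hc : IsChain (· ≤ ·) s)
    (hne : s.Nonempty) : IsMPrime (sInf s) := by
  obtain ⟨p₀, hp₀⟩ := hne
  refine ⟨(sInf_le hp₀).trans_lt (hs p₀ hp₀).1, fun a b hab => ?_⟩
  by_contra! h
  simp only [le_sInf_iff, not_forall] at h
  obtain ⟨⟨p, hp, hap⟩, q, hq, hbq⟩ := h
  obtain ⟨r, hr, hrp, hrq⟩ : ∃ r ∈ s, r ≤ p ∧ r ≤ q := by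
    rcases hc.total hp hq with hpq | hqp
    · exact ⟨p, hp, le_rfl, hpq⟩
    · exact ⟨q, hq, hqp, le_rfl⟩
  exact (hs r hr).mul_not_le (fun har => hap (har.trans hrp)) (fun hbr => hbq (hbr.trans hrq))
    (hab.trans (sInf_le hr))

theorem IsMPrime.exists_isMinimalMPrime_le {p : A} (hp : IsMPrime p) :
    ∃ q, IsMinimalMPrime q ∧ q ≤ p := by
  obtain ⟨q, hqp, hq⟩ := zorn_le_nonempty₀ (α := Aᵒᵈ) {x | IsMPrime (OrderDual.ofDual x)}
    (fun c hc hch y hy => ⟨OrderDual.toDual (sInf (OrderDual.toDual ⁻¹' c)),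
      isMPrime_sInf_of_isChain (fun _ hx => hc hx)
        (fun _ ha _ hb hab => (hch ha hb hab).symm) ⟨_, hy⟩,
      fun z hz => sInf_le (a := OrderDual.ofDual z) hz⟩) (OrderDual.toDual p) hp
  exact ⟨OrderDual.ofDual q, ⟨hq.1, fun _ hy hyq => hq.2 hy hyq⟩, hqp⟩

/-- A chosen minimal `m`-prime element below `p`. The argument has the common underlying type of
`SpecZ A` and `SpecF A`, so that the map can be considered in both topologies. -/
noncomputable def minBelow (p : {p : A // IsMPrime p}) : MinZ A :=
  ⟨⟨_, p.2.exists_isMinimalMPrime_le.choose_spec.1.1⟩,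
    p.2.exists_isMinimalMPrime_le.choose_spec.1⟩

theorem minBelow_le (p : {p : A // IsMPrime p}) : (minBelow p).1.1 ≤ p.1 :=
  p.2.exists_isMinimalMPrime_le.choose_spec.2

theorem minBelow_coe (q : MinZ A) : minBelow q.1 = q :=
  Subtype.ext (Subtype.ext (Minimal.eq_of_le q.2 (minBelow q.1).2.1 (minBelow_le q.1)))

theorem IsSemiprime.eq_bot_of_forall_le (hA : IsSemiprime A) {a : A}
    (h : ∀ p, IsMPrime p → a ≤ p) : a = ⊥ :=
  le_bot_iff.1 ((le_sInf fun p hp => h p hp.1).trans_eq hA)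

theorem IsSemiprime.eq_bot_of_forall_isMinimalMPrime_le (hA : IsSemiprime A) {a : A}
    (h : ∀ p, IsMinimalMPrime p → a ≤ p) : a = ⊥ :=
  hA.eq_bot_of_forall_le fun _ hp =>
    let ⟨q, hq, hqp⟩ := hp.exists_isMinimalMPrime_le
    (h q hq).trans hqp

end MPrime

section Coherent

variable {A : Type u} [CommMonoid A] [CompleteLattice A] [IsCoherent A]

theorem mul_top_eq (a : A) : a * ⊤ = a := by
  rw [← IsCoherent.one_eq_top, mul_one]

theorem IsMPrime.not_one_le {p : A} (hp : IsMPrime p) : ¬ 1 ≤ p := by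
  rw [IsCoherent.one_eq_top]
  exact hp.1.not_ge

theorem IsMPrime.le_of_pow_le {p a : A} (hp : IsMPrime p) {n : ℕ} (h : a ^ n ≤ p) : a ≤ p := by
  induction n with
  | zero => exact absurd (pow_zero a ▸ h) hp.not_one_le
  | succ n ih =>
    rw [pow_succ] at h
    exact (hp.2 _ _ h).elim ih id

theorem IsSemiprime.eq_bot_of_pow_eq_bot (hA : IsSemiprime A) {a : A} {n : ℕ} (h : a ^ n = ⊥) :
    a = ⊥ :=
  hA.eq_bot_of_forall_le fun _ hp => hp.le_of_pow_le (h.trans_le bot_le)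

end Coherent

section FlatTopology

variable {A : Type u} [CommMonoid A] [CompleteLattice A]

theorem isOpen_specF_le {c : A} (hc : IsCompactElement c) : IsOpen {p : SpecF A | c ≤ p.1} :=
  .basic _ ⟨c, hc, rfl⟩

theorem mem_of_le_of_isOpen_specF {U : Set (SpecF A)} (hU : IsOpen U) {p q : SpecF A}
    (hpq : p.1 ≤ q.1) (hp : p ∈ U) : q ∈ U := by
  induction hU with
  | basic s hs =>
    obtain ⟨c, -, rfl⟩ := hs
    exact le_trans hp hpq
  | univ => trivial
  | inter s t _ _ ihs iht => exact ⟨ihs hp.1, iht hp.2⟩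
  | sUnion S _ ih =>
    obtain ⟨s, hs, hps⟩ := hp
    exact ⟨s, hs, ih s hs hps⟩

variable [IsCompactlyGenerated A]

theorem IsMinimalMPrime.isClosed_singleton_specF {q : SpecF A} (hq : IsMinimalMPrime q.1) :
    IsClosed {q} := by
  rw [← isOpen_compl_iff, isOpen_iff_forall_mem_open]
  intro p hp
  have hpq : ¬ p.1 ≤ q.1 := fun h => hp (Subtype.ext (Minimal.eq_of_le hq p.2 h))
  obtain ⟨c, hc, hcp, hcq⟩ := exists_isCompactElement_le_not_le hpq
  refine ⟨_, ?_, isOpen_specF_le hc, hcp⟩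
  rintro r hr rfl
  exact hcq hr

theorem isMP_of_normalSpace_specF [NormalSpace (SpecF A)] : IsMP A := by
  intro p hp
  obtain ⟨q, hq, hqp⟩ := hp.exists_isMinimalMPrime_le
  refine ⟨q, ⟨hq, hqp⟩, fun r ⟨hr, hrp⟩ => ?_⟩
  by_contra hne
  obtain ⟨U, V, hU, hV, hqU, hrV, hUV⟩ := normal_separation
    (IsMinimalMPrime.isClosed_singleton_specF (q := ⟨q, hq.1⟩) hq)
    (IsMinimalMPrime.isClosed_singleton_specF (q := ⟨r, hr.1⟩) hr)
    (Set.disjoint_singleton.2 fun h => hne (congrArg Subtype.val h).symm)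
  exact Set.disjoint_left.1 hUV
    (mem_of_le_of_isOpen_specF (q := ⟨p, hp⟩) hU hqp (hqU rfl))
    (mem_of_le_of_isOpen_specF (q := ⟨p, hp⟩) hV hrp (hrV rfl))

end FlatTopology

section Quantale

variable {A : Type u} [CommMonoid A] [CompleteLattice A] [IsQuantale A]

theorem le_perp_iff {a x : A} : x ≤ perp a ↔ a * x = ⊥ := by
  refine ⟨fun h => le_bot_iff.1 ?_, fun h => le_sSup h⟩
  calc a * x ≤ a * perp a := mul_le_mul_right h a
    _ = ⨆ y ∈ {y | a * y = ⊥}, a * y := mul_sSup_distrib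
    _ ≤ ⊥ := iSup₂_le fun _ hy => le_of_eq hy

theorem mul_perp (a : A) : a * perp a = ⊥ := le_perp_iff.1 le_rfl

theorem perp_anti {a b : A} (h : a ≤ b) : perp b ≤ perp a :=
  le_perp_iff.2 (le_bot_iff.1 ((mul_le_mul_left h _).trans_eq (mul_perp b)))

theorem IsMPrime.perp_le {p a : A} (hp : IsMPrime p) (h : ¬ a ≤ p) : perp a ≤ p :=
  (hp.2 a (perp a) ((mul_perp a).trans_le bot_le)).resolve_left h

theorem isPF_iff_perp_sup_perp_eq_top : IsPF A ↔ ∀ c d : A, IsCompactElement c →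
    IsCompactElement d → c * d = ⊥ → perp c ⊔ perp d = ⊤ :=
  ⟨fun h c d hc hd hcd => h c hc d hd (le_perp_iff.2 hcd),
    fun h c hc d hd hcd => h c d hc hd (le_perp_iff.1 hcd)⟩

end Quantale

section PrimeElements

variable {A : Type u} [CommMonoid A] [CompleteLattice A] [IsQuantale A] [IsCoherent A]

theorem perp_eq_top_iff {a : A} : perp a = ⊤ ↔ a = ⊥ := by
  rw [← top_le_iff, le_perp_iff, mul_top_eq]

theorem sup_mul_sup_le (a b c : A) : (a ⊔ b) * (a ⊔ c) ≤ a ⊔ b * c := by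
  rw [Quantale.mul_sup_distrib]
  refine sup_le ((mul_le_right' _ _).trans le_sup_left) ?_
  rw [Quantale.sup_mul_distrib]
  exact sup_le_sup_right (mul_le_left' _ _) _

variable (A) in
/-- The multiplicative monoid `K(A)`, as a submonoid of `A`, so that the multiplicatively closed
sets of compact elements used to build `m`-prime elements are the submonoids below it. -/
def compactElements : Submonoid A where
  carrier := {c | IsCompactElement c}
  one_mem' := by
    rw [IsCoherent.one_eq_top]
    exact IsCoherent.isCompact_top
  mul_mem' ha hb := IsCoherent.isCompact_mul _ _ ha hb

/-- The multiplicatively closed set of compact elements not below an `m`-prime element `p`: the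
analogue of the complement of a prime ideal, by which one localizes at `p`. -/
def IsMPrime.compactCompl {p : A} (hp : IsMPrime p) : Submonoid A where
  carrier := {c | IsCompactElement c ∧ ¬ c ≤ p}
  one_mem' := ⟨(compactElements A).one_mem, hp.not_one_le⟩
  mul_mem' ha hb := ⟨(compactElements A).mul_mem ha.1 hb.1, hp.mul_not_le ha.2 hb.2⟩

/-- Compactness of the members of `S` lets Zorn's lemma produce a maximal element above `a` that
is above no member of `S`; multiplicativity of `S` makes it `m`-prime. -/
theorem exists_isMPrime_ge_forall_not_le {S : Submonoid A} (hS : S ≤ compactElements A) {a : A}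
    (ha : ∀ s ∈ S, ¬ s ≤ a) : ∃ p, IsMPrime p ∧ a ≤ p ∧ ∀ s ∈ S, ¬ s ≤ p := by
  obtain ⟨p, hap, hp⟩ := zorn_le_nonempty₀ {x : A | ∀ s ∈ S, ¬ s ≤ x}
    (fun c hc hch y hy => ⟨sSup c, fun s hs hle => by
      obtain ⟨x, hx, hsx⟩ := hS hs c (sSup c) ⟨y, hy⟩ hch.directedOn (isLUB_sSup c) hle
      exact hc hx s hs hsx, fun _ hz => le_sSup hz⟩) a ha
  have exists_le_sup : ∀ x : A, ¬ x ≤ p → ∃ s ∈ S, s ≤ p ⊔ x := fun x hx => by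
    by_contra! h
    exact hx (le_sup_right.trans (hp.2 (y := p ⊔ x) h le_sup_left))
  refine ⟨p, ⟨lt_top_iff_ne_top.2 ?_, fun x y hxy => ?_⟩, hap, hp.1⟩
  · rintro rfl
    exact hp.1 1 S.one_mem le_top
  · by_contra! h
    obtain ⟨s, hs, hsx⟩ := exists_le_sup x h.1
    obtain ⟨t, ht, hty⟩ := exists_le_sup y h.2
    refine hp.1 _ (S.mul_mem hs ht) ?_
    calc s * t ≤ (p ⊔ x) * (p ⊔ y) := mul_le_mul' hsx hty
      _ ≤ p ⊔ x * y := sup_mul_sup_le p x y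
      _ ≤ p := sup_le le_rfl hxy

theorem exists_isMPrime_ge {a : A} (ha : a ≠ ⊤) : ∃ p, IsMPrime p ∧ a ≤ p := by
  obtain ⟨p, hp, hap, -⟩ := exists_isMPrime_ge_forall_not_le (S := ⊥) bot_le (a := a) (by
    rintro _ rfl hle
    exact ha (top_le_iff.1 (IsCoherent.one_eq_top (A := A) ▸ hle)))
  exact ⟨p, hp, hap⟩

end PrimeElements

section Semiprime

variable {A : Type u} [CommMonoid A] [CompleteLattice A] [IsQuantale A] [IsCoherent A]

theorem isSemiprime_of_forall_pow_eq_bot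
    (h : ∀ c : A, IsCompactElement c → ∀ n : ℕ, c ^ n = ⊥ → c = ⊥) : IsSemiprime A := by
  refine le_bot_iff.1 (le_iff_compact_le_imp.2 fun c hc hcr => ?_)
  by_contra hne
  obtain ⟨p, hp, -, hpc⟩ :=
    exists_isMPrime_ge_forall_not_le (S := .powers c) (Submonoid.powers_le.2 hc) (a := ⊥) (by
      rintro _ ⟨n, rfl⟩ hle
      exact hne (h c hc n (le_bot_iff.1 hle)).le)
  exact hpc c (Submonoid.mem_powers c) (hcr.trans (sInf_le ⟨hp, bot_le⟩))

theorem IsSemiprime.mul_eq_bot_of_pow_mul_eq_bot (hA : IsSemiprime A) {a b : A} {n : ℕ}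
    (h : a ^ n * b = ⊥) : a * b = ⊥ := by
  refine hA.eq_bot_of_pow_eq_bot (n := n + 1) (le_bot_iff.1 ?_)
  calc (a * b) ^ (n + 1) = a ^ n * b * (a * b ^ n) := by
        rw [mul_pow, pow_succ, pow_succ', mul_mul_mul_comm]
    _ ≤ a ^ n * b := mul_le_left' _ _
    _ = ⊥ := h

theorem IsSemiprime.exists_isMinimalMPrime_le_not_ge (hA : IsSemiprime A) {c p : A}
    (hc : IsCompactElement c) (hp : IsMPrime p) (h : perp c ≤ p) :
    ∃ q, IsMinimalMPrime q ∧ q ≤ p ∧ ¬ c ≤ q := by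
  obtain ⟨q, hq, -, hqS⟩ := exists_isMPrime_ge_forall_not_le (a := ⊥)
    (S := .powers c ⊔ hp.compactCompl) (sup_le (Submonoid.powers_le.2 hc) fun _ ht => ht.1) (by
      intro s hs hle
      obtain ⟨_, ⟨n, rfl⟩, t, ht, rfl⟩ := Submonoid.mem_sup.1 hs
      have hct : c * t = ⊥ := hA.mul_eq_bot_of_pow_mul_eq_bot (le_bot_iff.1 hle)
      exact ht.2 ((le_perp_iff.2 hct).trans h))
  have hqp : q ≤ p := le_iff_compact_le_imp.2 fun t ht htq => by
    by_contra htp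
    exact hqS t (Submonoid.mem_sup_right ⟨ht, htp⟩) htq
  obtain ⟨r, hr, hrq⟩ := hq.exists_isMinimalMPrime_le
  exact ⟨r, hr, hrq.trans hqp, fun hcr =>
    hqS c (Submonoid.mem_sup_left (Submonoid.mem_powers c)) (hcr.trans hrq)⟩

theorem IsMinimalMPrime.le_iff_not_perp_le (hA : IsSemiprime A) {c p : A}
    (hc : IsCompactElement c) (hp : IsMinimalMPrime p) : c ≤ p ↔ ¬ perp c ≤ p := by
  refine ⟨fun hcp h => ?_, fun h => by_contra fun hcp => h (hp.1.perp_le hcp)⟩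
  obtain ⟨q, hq, hqp, hcq⟩ := hA.exists_isMinimalMPrime_le_not_ge hc hp.1 h
  exact hcq (hcp.trans (hp.2 hq.1 hqp))

theorem IsMinimalMPrime.exists_mul_eq_bot_not_le (hA : IsSemiprime A) {c p : A}
    (hc : IsCompactElement c) (hp : IsMinimalMPrime p) (hcp : c ≤ p) :
    ∃ d, IsCompactElement d ∧ c * d = ⊥ ∧ ¬ d ≤ p := by
  obtain ⟨d, hd, hdc, hdp⟩ :=
    exists_isCompactElement_le_not_le ((hp.le_iff_not_perp_le hA hc).1 hcp)
  exact ⟨d, hd, le_perp_iff.1 hdc, hdp⟩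

end Semiprime

section Complemented

variable {A : Type u} [CommMonoid A] [CompleteLattice A] [IsQuantale A] [IsCoherent A]

theorem mul_eq_bot_of_disjoint {a b : A} (h : Disjoint a b) : a * b = ⊥ :=
  le_bot_iff.1 (h (mul_le_left' a b) (mul_le_right' a b))

theorem IsSemiprime.disjoint_iff_mul_eq_bot (hA : IsSemiprime A) {a b : A} :
    Disjoint a b ↔ a * b = ⊥ := by
  refine ⟨mul_eq_bot_of_disjoint, fun h =>
    disjoint_iff.2 (hA.eq_bot_of_pow_eq_bot (n := 2) (le_bot_iff.1 ?_))⟩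
  calc (a ⊓ b) ^ 2 = (a ⊓ b) * (a ⊓ b) := sq _
    _ ≤ a * b := mul_le_mul' inf_le_left inf_le_right
    _ = ⊥ := h

theorem le_of_mul_eq_bot_of_codisjoint {a e f : A} (hef : Codisjoint e f) (h : a * f = ⊥) :
    a ≤ e := by
  calc a = a * (e ⊔ f) := by rw [hef.eq_top, mul_top_eq]
    _ = a * e := by rw [Quantale.mul_sup_distrib, h, sup_bot_eq]
    _ ≤ e := mul_le_right' _ _

theorem isCompactElement_of_isCompl {e f : A} (h : IsCompl e f) : IsCompactElement e := by
  obtain ⟨s, hs, hse, hsf⟩ :=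
    exists_isCompactElement_le_sup IsCoherent.isCompact_top h.sup_eq_top.ge
  have hes : e ≤ s := le_of_mul_eq_bot_of_codisjoint (codisjoint_iff_le_sup.2 hsf)
    (mul_eq_bot_of_disjoint h.disjoint)
  exact le_antisymm hes hse ▸ hs

theorem IsSemiprime.le_of_pow_le_of_isCompl (hA : IsSemiprime A) {a e f : A} (h : IsCompl e f)
    {n : ℕ} (hn : a ^ n ≤ e) : a ≤ e := by
  refine le_of_mul_eq_bot_of_codisjoint h.codisjoint
    (hA.mul_eq_bot_of_pow_mul_eq_bot (n := n) (le_bot_iff.1 ?_))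
  exact (mul_le_mul_left hn f).trans_eq (mul_eq_bot_of_disjoint h.disjoint)

theorem IsMPrime.not_le_iff_of_isCompl {p e f : A} (hp : IsMPrime p) (h : IsCompl e f) :
    ¬ e ≤ p ↔ f ≤ p := by
  refine ⟨fun he => ?_, fun hf he => hp.1.not_ge (h.sup_eq_top.ge.trans (sup_le he hf))⟩
  exact (hp.2 e f ((mul_eq_bot_of_disjoint h.disjoint).trans_le bot_le)).resolve_left he

theorem IsMPrime.le_iff_of_isComplemented {p q e : A} (hp : IsMPrime p) (hq : IsMPrime q)
    (hqp : q ≤ p) (h : IsComplemented e) : e ≤ q ↔ e ≤ p := by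
  obtain ⟨f, hf⟩ := h
  refine ⟨fun he => he.trans hqp, fun he => by_contra fun heq => ?_⟩
  exact (hp.not_le_iff_of_isCompl hf).2 (((hq.not_le_iff_of_isCompl hf).1 heq).trans hqp) he

end Complemented

section PFQuantales

variable {A : Type u} [CommMonoid A] [CompleteLattice A] [IsQuantale A] [IsCoherent A]

theorem IsPP.isPF (h : IsPP A) : IsPF A := by
  refine isPF_iff_perp_sup_perp_eq_top.2 fun c d hc _ hcd => ?_
  obtain ⟨f, hf⟩ := h c hc
  have hfd : f ≤ perp d := le_perp_iff.2 <| le_bot_iff.1 <|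
    (mul_le_mul_left (le_perp_iff.2 hcd) f).trans_eq (mul_eq_bot_of_disjoint hf.disjoint)
  exact top_le_iff.1 (hf.sup_eq_top.ge.trans (sup_le_sup_left hfd _))

theorem IsPF.isSemiprime (h : IsPF A) : IsSemiprime A := by
  refine isSemiprime_of_forall_pow_eq_bot fun c hc n hn => ?_
  induction n with
  | zero =>
    rw [pow_zero, IsCoherent.one_eq_top] at hn
    exact le_bot_iff.1 (hn ▸ le_top)
  | succ n ih =>
    rcases n with _ | n
    · rwa [zero_add, pow_one] at hn
    · have hle : perp c ≤ perp (c ^ (n + 1)) := perp_anti (pow_succ c n ▸ mul_le_right' _ _)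
      have hsup : perp (c ^ (n + 1)) ⊔ perp c = ⊤ := isPF_iff_perp_sup_perp_eq_top.1 h _ c
        ((compactElements A).pow_mem hc _) hc (pow_succ c (n + 1) ▸ hn)
      exact ih (perp_eq_top_iff.1 (sup_eq_left.2 hle ▸ hsup))

theorem IsPF.isMP (h : IsPF A) : IsMP A := by
  intro p hp
  obtain ⟨q, hq, hqp⟩ := hp.exists_isMinimalMPrime_le
  refine ⟨q, ⟨hq, hqp⟩, fun r ⟨hr, hrp⟩ => ?_⟩
  by_contra hne
  obtain ⟨c, hc, hcr, hcq⟩ :=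
    exists_isCompactElement_le_not_le fun hrq => hne (Minimal.eq_of_le hq hr.1 hrq)
  obtain ⟨d, hd, hcd, hdr⟩ := hr.exists_mul_eq_bot_not_le h.isSemiprime hc hcr
  have hsup : perp c ⊔ perp d ≤ p :=
    sup_le ((hq.1.perp_le hcq).trans hqp) ((hr.1.perp_le hdr).trans hrp)
  exact hp.1.not_ge ((isPF_iff_perp_sup_perp_eq_top.1 h c d hc hd hcd).ge.trans hsup)

theorem IsMP.isPF (h : IsMP A) (hA : IsSemiprime A) : IsPF A := by
  refine isPF_iff_perp_sup_perp_eq_top.2 fun c d hc hd hcd => ?_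
  by_contra hne
  obtain ⟨p, hp, hle⟩ := exists_isMPrime_ge hne
  obtain ⟨q, hq, hqp, hcq⟩ := hA.exists_isMinimalMPrime_le_not_ge hc hp (le_sup_left.trans hle)
  obtain ⟨r, hr, hrp, hdr⟩ := hA.exists_isMinimalMPrime_le_not_ge hd hp (le_sup_right.trans hle)
  obtain rfl : q = r := (h p hp).unique ⟨hq, hqp⟩ ⟨hr, hrp⟩
  exact hq.1.mul_not_le hcq hdr (hcd.trans_le bot_le)

end PFQuantales

section Topology

variable {A : Type u} [CommMonoid A] [CompleteLattice A] [IsQuantale A] [IsCoherent A]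

theorem isClosed_specZ_iff {s : Set (SpecZ A)} :
    IsClosed s ↔ ∃ a : A, {p : SpecZ A | a ≤ p.1} = s := by
  rw [← isOpen_compl_iff]
  change sᶜᶜ ∈ Set.range _ ↔ _
  rw [compl_compl]
  rfl

theorem isClosed_specZ_le (a : A) : IsClosed {p : SpecZ A | a ≤ p.1} :=
  isClosed_specZ_iff.2 ⟨a, rfl⟩

theorem continuous_specZ_iff {X : Type v} [TopologicalSpace X] {f : X → SpecZ A} :
    Continuous f ↔ ∀ c : A, IsCompactElement c → IsClosed {x | c ≤ (f x).1} := by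
  refine ⟨fun h c _ => (isClosed_specZ_le c).preimage h, fun h => continuous_iff_isClosed.2 ?_⟩
  intro s hs
  obtain ⟨a, rfl⟩ := isClosed_specZ_iff.1 hs
  have hpre : f ⁻¹' {p : SpecZ A | a ≤ p.1} =
      ⋂ (c : A) (_ : IsCompactElement c) (_ : c ≤ a), {x | c ≤ (f x).1} := by
    ext x
    simp only [Set.mem_iInter]
    exact le_iff_compact_le_imp
  rw [hpre]
  exact isClosed_iInter fun c => isClosed_iInter fun hc => isClosed_iInter fun _ => h c hc

instance : CompactSpace (SpecZ A) := by
  refine ⟨isCompact_of_finite_subfamily_closed fun t ht hempty => ?_⟩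
  choose a ha using fun i => isClosed_specZ_iff.1 (ht i)
  obtain rfl : (fun i => {p : SpecZ A | a i ≤ p.1}) = t := funext ha
  have htop : ⨆ i, a i = ⊤ := by
    by_contra hne
    obtain ⟨p, hp, hle⟩ := exists_isMPrime_ge hne
    exact Set.eq_empty_iff_forall_notMem.1 hempty ⟨p, hp⟩
      ⟨trivial, Set.mem_iInter.2 fun i => (le_iSup a i).trans hle⟩
  obtain ⟨u, hu⟩ := CompleteLattice.IsCompactElement.exists_finset_of_le_iSup A
    IsCoherent.isCompact_top a htop.ge
  exact ⟨u, Set.eq_empty_iff_forall_notMem.2 fun p ⟨_, hp⟩ =>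
    p.2.1.not_ge (hu.trans (iSup₂_le fun i hi => Set.mem_iInter₂.1 hp i hi))⟩

theorem isClosed_minZ_le (a : A) : IsClosed {q : MinZ A | a ≤ q.1.1} :=
  (isClosed_specZ_le a).preimage continuous_subtype_val

theorem isOpen_minZ_not_le (a : A) : IsOpen {q : MinZ A | ¬ a ≤ q.1.1} :=
  (isClosed_minZ_le a).isOpen_compl

theorem continuous_minZ_iff {X : Type v} [TopologicalSpace X] {f : X → MinZ A} :
    Continuous f ↔ ∀ c : A, IsCompactElement c → IsClosed {x | c ≤ (f x).1.1} :=
  continuous_induced_rng.trans continuous_specZ_iff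

theorem IsSemiprime.isClopen_minZ_le (hA : IsSemiprime A) {c : A} (hc : IsCompactElement c) :
    IsClopen {q : MinZ A | c ≤ q.1.1} := by
  refine ⟨isClosed_minZ_le c, ?_⟩
  have heq : {q : MinZ A | c ≤ q.1.1} = {q : MinZ A | ¬ perp c ≤ q.1.1} :=
    Set.ext fun q => q.2.le_iff_not_perp_le hA hc
  exact heq ▸ isOpen_minZ_not_le (perp c)

theorem IsSemiprime.totallySeparatedSpace_minZ (hA : IsSemiprime A) :
    TotallySeparatedSpace (MinZ A) := by
  refine totallySeparatedSpace_iff_exists_isClopen.2 fun p q hpq => ?_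
  have hle : ¬ p.1.1 ≤ q.1.1 := fun h =>
    hpq (Subtype.ext (Subtype.ext (Minimal.eq_of_le q.2 p.2.1 h)))
  obtain ⟨c, hc, hcp, hcq⟩ := exists_isCompactElement_le_not_le hle
  exact ⟨{r | c ≤ r.1.1}, hA.isClopen_minZ_le hc, hcp, hcq⟩

theorem IsSemiprime.isBooleanSpace_minZ_iff (hA : IsSemiprime A) :
    IsBooleanSpace (MinZ A) ↔ CompactSpace (MinZ A) := by
  have := hA.totallySeparatedSpace_minZ
  exact ⟨fun h => h.1, fun h => ⟨h, inferInstance, inferInstance⟩⟩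

theorem IsSemiprime.exists_mul_eq_bot_forall_not_le (hA : IsSemiprime A) [CompactSpace (MinZ A)]
    {c : A} (hc : IsCompactElement c) : ∃ d, IsCompactElement d ∧ c * d = ⊥ ∧
      ∀ q, IsMinimalMPrime q → c ≤ q → ¬ d ≤ q := by
  obtain ⟨⟨d, hd, hcd⟩, hsub⟩ := (isClosed_minZ_le c).isCompact.elim_directed_cover
    (ι := {d : A // IsCompactElement d ∧ c * d = ⊥}) (hι := ⟨⟨⊥, isCompact_bot, Quantale.mul_bot⟩⟩)
    (fun d => {q : MinZ A | ¬ d.1 ≤ q.1.1}) (fun d => isOpen_minZ_not_le d.1)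
    (fun q hq => by
      obtain ⟨d, hd, hcd, hdq⟩ := q.2.exists_mul_eq_bot_not_le hA hc hq
      exact Set.mem_iUnion.2 ⟨⟨d, hd, hcd⟩, hdq⟩)
    (fun d e => ⟨⟨d.1 ⊔ e.1, isCompact_sup d.2.1 e.2.1, by
        rw [Quantale.mul_sup_distrib, d.2.2, e.2.2, sup_bot_eq]⟩,
      fun q hq hle => hq (le_sup_left.trans hle), fun q hq hle => hq (le_sup_right.trans hle)⟩)
  exact ⟨d, hd, hcd, fun q hq hcq => hsub (a := (⟨⟨q, hq.1⟩, hq⟩ : MinZ A)) hcq⟩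

theorem IsPF.isPP (h : IsPF A) [CompactSpace (MinZ A)] : IsPP A := by
  intro c hc
  obtain ⟨d, hd, hcd, hmin⟩ := h.isSemiprime.exists_mul_eq_bot_forall_not_le hc
  have hinf : perp c ⊓ perp d = ⊥ :=
    h.isSemiprime.eq_bot_of_forall_isMinimalMPrime_le fun q hq => by
      by_cases hcq : c ≤ q
      · exact inf_le_right.trans (hq.1.perp_le (hmin q hq hcq))
      · exact inf_le_left.trans (hq.1.perp_le hcq)
  exact ⟨perp d, .of_eq hinf (isPF_iff_perp_sup_perp_eq_top.1 h c d hc hd hcd)⟩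

/-- The inclusion of `Min(A)` into `Spec(A)` with the flat topology. -/
def MinZ.toSpecF (q : MinZ A) : SpecF A := ⟨q.1.1, q.1.2⟩

theorem MinZ.continuous_toSpecF (hA : IsSemiprime A) :
    Continuous (MinZ.toSpecF : MinZ A → SpecF A) := by
  refine continuous_generateFrom_iff.2 ?_
  rintro _ ⟨c, hc, rfl⟩
  exact (hA.isClopen_minZ_le hc).isOpen

theorem IsPP.le_minBelow_iff (h : IsPP A) {c : A} (hc : IsCompactElement c)
    (p : {p : A // IsMPrime p}) : c ≤ (minBelow p).1.1 ↔ ¬ perp c ≤ p.1 :=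
  ((minBelow p).2.le_iff_not_perp_le h.isPF.isSemiprime hc).trans
    (not_congr (p.2.le_iff_of_isComplemented (minBelow p).1.2 (minBelow_le p) (h c hc)))

theorem IsPP.continuous_minBelow_specZ (h : IsPP A) :
    Continuous fun p : SpecZ A => minBelow p := by
  refine continuous_minZ_iff.2 fun c hc => ?_
  obtain ⟨f, hf⟩ := h c hc
  have heq : {p : SpecZ A | c ≤ (minBelow p).1.1} = {p : SpecZ A | f ≤ p.1} :=
    Set.ext fun p => (h.le_minBelow_iff hc p).trans (p.2.not_le_iff_of_isCompl hf)
  exact heq ▸ isClosed_specZ_le f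

theorem IsPP.continuous_minBelow_specF (h : IsPP A) :
    Continuous fun p : SpecF A => minBelow p := by
  refine continuous_minZ_iff.2 fun c hc => ?_
  obtain ⟨f, hf⟩ := h c hc
  have heq : {p : SpecF A | c ≤ (minBelow p).1.1} = {p : SpecF A | perp c ≤ p.1}ᶜ :=
    Set.ext fun p => h.le_minBelow_iff hc p
  exact heq ▸ (isOpen_specF_le (isCompactElement_of_isCompl hf)).isClosed_compl

theorem IsPP.compactSpace_minZ (h : IsPP A) : CompactSpace (MinZ A) :=
  (show Function.Surjective fun p : SpecZ A => minBelow p from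
    fun q => ⟨q.1, minBelow_coe q⟩).compactSpace h.continuous_minBelow_specZ

theorem IsPP.normalSpace_specF (h : IsPP A) : NormalSpace (SpecF A) := by
  have hA := h.isPF.isSemiprime
  obtain ⟨_, _, _⟩ := hA.isBooleanSpace_minZ_iff.2 h.compactSpace_minZ
  refine ⟨fun F G hF hG hFG => ?_⟩
  have subset_preimage : ∀ {C : Set (SpecF A)}, IsClosed C →
      C ⊆ (fun p : SpecF A => minBelow p) ⁻¹' (MinZ.toSpecF ⁻¹' C) :=
    fun hC p hp => by_contra fun hn =>
      mem_of_le_of_isOpen_specF hC.isOpen_compl (minBelow_le p) hn hp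
  have hι := MinZ.continuous_toSpecF hA
  have hsep : SeparatedNhds (MinZ.toSpecF ⁻¹' F) (MinZ.toSpecF ⁻¹' G) :=
    normal_separation (hF.preimage hι) (hG.preimage hι) (hFG.preimage _)
  exact (hsep.preimage h.continuous_minBelow_specF).mono (subset_preimage hF) (subset_preimage hG)

end Topology

section Reticulation

variable {A : Type u} [CommMonoid A] [CompleteLattice A] [IsQuantale A] [IsCoherent A]
  {L : Type v} [DistribLattice L] [BoundedOrder L] {f : K A → L}

namespace IsReticulation

theorem map_le_map_of_le (hf : IsReticulation f) {a b : K A} (h : a.1 ≤ b.1) : f a ≤ f b :=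
  (hf.map_le_map_iff a b).2 (ReticLE.of_le h)

theorem map_sup (hf : IsReticulation f) (a b : K A) : f (a.sup b) = f a ⊔ f b :=
  (hf.map_sup_le a b).antisymm
    (sup_le (hf.map_le_map_of_le le_sup_left) (hf.map_le_map_of_le le_sup_right))

theorem map_bot (hf : IsReticulation f) : f ⟨⊥, isCompact_bot⟩ = ⊥ := by
  obtain ⟨c, hc⟩ := hf.surjective ⊥
  exact le_bot_iff.1 (hc ▸ hf.map_le_map_of_le bot_le)

theorem map_top (hf : IsReticulation f) : f ⟨⊤, IsCoherent.isCompact_top⟩ = ⊤ := by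
  obtain ⟨c, hc⟩ := hf.surjective ⊤
  exact top_le_iff.1 (hc ▸ hf.map_le_map_of_le le_top)

theorem map_eq_top_iff (hf : IsReticulation f) {c : K A} : f c = ⊤ ↔ c.1 = ⊤ := by
  refine ⟨fun h => ?_, fun h => top_le_iff.1 (hf.map_top.ge.trans (hf.map_le_map_of_le h.ge))⟩
  obtain ⟨n, -, hn⟩ := (hf.map_le_map_iff ⟨⊤, IsCoherent.isCompact_top⟩ c).1 (le_top.trans h.ge)
  have hone : (1 : A) ^ n ≤ c.1 := IsCoherent.one_eq_top (A := A) ▸ hn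
  rwa [one_pow, IsCoherent.one_eq_top, top_le_iff] at hone

theorem map_eq_bot_iff (hf : IsReticulation f) (hA : IsSemiprime A) {c : K A} :
    f c = ⊥ ↔ c.1 = ⊥ := by
  refine ⟨fun h => ?_, fun h => le_bot_iff.1 ((hf.map_le_map_of_le h.le).trans hf.map_bot.le)⟩
  obtain ⟨n, -, hn⟩ := (hf.map_le_map_iff c ⟨⊥, isCompact_bot⟩).1 (h.le.trans bot_le)
  exact hA.eq_bot_of_pow_eq_bot (le_bot_iff.1 hn)

theorem map_sup_map_eq_top_iff (hf : IsReticulation f) {c d : K A} :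
    f c ⊔ f d = ⊤ ↔ c.1 ⊔ d.1 = ⊤ := by
  rw [← hf.map_sup]
  exact hf.map_eq_top_iff

theorem map_inf_map_eq_bot_iff (hf : IsReticulation f) (hA : IsSemiprime A) {c d : K A} :
    f c ⊓ f d = ⊥ ↔ c.1 * d.1 = ⊥ := by
  rw [← hf.map_mul]
  exact hf.map_eq_bot_iff hA

theorem isCompl_map_iff (hf : IsReticulation f) (hA : IsSemiprime A) {c d : K A} :
    IsCompl (f c) (f d) ↔ IsCompl c.1 d.1 := by
  rw [isCompl_iff, isCompl_iff, disjoint_iff, codisjoint_iff, codisjoint_iff,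
    hf.map_inf_map_eq_bot_iff hA, hf.map_sup_map_eq_top_iff, hA.disjoint_iff_mul_eq_bot]

theorem map_le_map_iff_of_isComplemented (hf : IsReticulation f) (hA : IsSemiprime A) {c e : K A}
    (he : IsComplemented e.1) : f c ≤ f e ↔ c.1 ≤ e.1 := by
  obtain ⟨e', he'⟩ := he
  exact ⟨fun h => let ⟨_, _, hn⟩ := (hf.map_le_map_iff c e).1 h
    hA.le_of_pow_le_of_isCompl he' hn, hf.map_le_map_of_le⟩

theorem annihilator_eq_Iic_iff (hf : IsReticulation f) (hA : IsSemiprime A) {c e : K A}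
    (he : IsComplemented e.1) : {y | f c ⊓ y = ⊥} = Set.Iic (f e) ↔ perp c.1 = e.1 := by
  have hmem : ∀ d : K A, (f c ⊓ f d = ⊥ ↔ f d ≤ f e) ↔ (d.1 ≤ perp c.1 ↔ d.1 ≤ e.1) := fun d => by
    rw [hf.map_inf_map_eq_bot_iff hA, hf.map_le_map_iff_of_isComplemented hA he, le_perp_iff]
  rw [Set.ext_iff, hf.surjective.forall]
  refine (forall_congr' hmem).trans ⟨fun h => le_antisymm ?_ ?_, fun h d => by rw [h]⟩
  · exact le_iff_compact_le_imp.2 fun d hd => (h ⟨d, hd⟩).1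
  · exact (h e).2 le_rfl

theorem isStoneLattice_iff (hf : IsReticulation f) (hA : IsSemiprime A) :
    IsStoneLattice L ↔ IsPP A := by
  constructor
  · intro h c hc
    obtain ⟨x, ⟨y, hxy⟩, hx⟩ := h (f ⟨c, hc⟩)
    obtain ⟨e, rfl⟩ := hf.surjective x
    obtain ⟨e', rfl⟩ := hf.surjective y
    have he : IsComplemented e.1 := ⟨e'.1, (hf.isCompl_map_iff hA).1 hxy⟩
    exact ((hf.annihilator_eq_Iic_iff hA he).1 hx : perp c = e.1) ▸ he
  · intro h x
    obtain ⟨c, rfl⟩ := hf.surjective x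
    obtain ⟨e', he'⟩ := h c.1 c.2
    refine ⟨f ⟨perp c.1, isCompactElement_of_isCompl he'⟩,
      ⟨f ⟨e', isCompactElement_of_isCompl he'.symm⟩, (hf.isCompl_map_iff hA).2 he'⟩, ?_⟩
    exact (hf.annihilator_eq_Iic_iff hA ⟨e', he'⟩).2 rfl

theorem isConormalLattice_iff (hf : IsReticulation f) (hA : IsSemiprime A) :
    IsConormalLattice L ↔ IsPF A := by
  rw [isPF_iff_perp_sup_perp_eq_top]
  constructor
  · intro h c d hc hd hcd
    obtain ⟨x, y, hx, hy, hxy⟩ := h (f ⟨c, hc⟩) (f ⟨d, hd⟩) ((hf.map_inf_map_eq_bot_iff hA).2 hcd)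
    obtain ⟨s, rfl⟩ := hf.surjective x
    obtain ⟨t, rfl⟩ := hf.surjective y
    have hs : s.1 ≤ perp c := le_perp_iff.2 ((hf.map_inf_map_eq_bot_iff hA).1 hx)
    have ht : t.1 ≤ perp d := le_perp_iff.2 ((hf.map_inf_map_eq_bot_iff hA).1 hy)
    exact top_le_iff.1 ((hf.map_sup_map_eq_top_iff.1 hxy).ge.trans (sup_le_sup hs ht))
  · intro h x y hxy
    obtain ⟨c, rfl⟩ := hf.surjective x
    obtain ⟨d, rfl⟩ := hf.surjective y
    have htop := (h c.1 d.1 c.2 d.2 ((hf.map_inf_map_eq_bot_iff hA).1 hxy)).ge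
    obtain ⟨s, hs, hsc, hsd⟩ := exists_isCompactElement_le_sup IsCoherent.isCompact_top htop
    obtain ⟨t, ht, htd, hts⟩ :=
      exists_isCompactElement_le_sup IsCoherent.isCompact_top (sup_comm s (perp d.1) ▸ hsd)
    exact ⟨f ⟨s, hs⟩, f ⟨t, ht⟩, (hf.map_inf_map_eq_bot_iff hA).2 (le_perp_iff.1 hsc),
      (hf.map_inf_map_eq_bot_iff hA).2 (le_perp_iff.1 htd),
      hf.map_sup_map_eq_top_iff.2 (top_le_iff.1 (sup_comm t s ▸ hts))⟩

/-- The prime ideal `{λ(c) : c ≤ p}` of the reticulation that corresponds to an `m`-prime element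
`p`; it is shown to be prime in `IsReticulation.isPrime_specIdeal`. -/
def specIdeal (hf : IsReticulation f) (p : SpecZ A) : Order.Ideal L :=
  Order.IsIdeal.toIdeal (I := {x | ∃ c : K A, f c = x ∧ c.1 ≤ p.1})
    { IsLowerSet := by
        rintro _ y hyx ⟨c, rfl, hc⟩
        obtain ⟨d, rfl⟩ := hf.surjective y
        obtain ⟨n, -, hn⟩ := (hf.map_le_map_iff d c).1 hyx
        exact ⟨d, rfl, p.2.le_of_pow_le (hn.trans hc)⟩
      Nonempty := ⟨_, ⟨⊥, isCompact_bot⟩, rfl, bot_le⟩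
      Directed := by
        rintro _ ⟨c, rfl, hc⟩ _ ⟨d, rfl, hd⟩
        exact ⟨f (c.sup d), ⟨c.sup d, rfl, sup_le hc hd⟩, hf.map_le_map_of_le le_sup_left,
          hf.map_le_map_of_le le_sup_right⟩ }

theorem map_mem_specIdeal (hf : IsReticulation f) {p : SpecZ A} {c : K A} :
    f c ∈ hf.specIdeal p ↔ c.1 ≤ p.1 := by
  refine ⟨?_, fun h => ⟨c, rfl, h⟩⟩
  rintro ⟨d, hdc, hd⟩
  obtain ⟨n, -, hn⟩ := (hf.map_le_map_iff c d).1 hdc.ge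
  exact p.2.le_of_pow_le (hn.trans hd)

theorem isPrime_specIdeal (hf : IsReticulation f) (p : SpecZ A) : (hf.specIdeal p).IsPrime := by
  have : (hf.specIdeal p).IsProper := Order.Ideal.isProper_of_notMem (p := ⊤) fun h =>
    p.2.1.not_ge (hf.map_mem_specIdeal.1 (hf.map_top.symm ▸ h))
  refine Order.Ideal.IsPrime.of_mem_or_mem fun {x y} hxy => ?_
  obtain ⟨c, rfl⟩ := hf.surjective x
  obtain ⟨d, rfl⟩ := hf.surjective y
  rw [← hf.map_mul, hf.map_mem_specIdeal] at hxy
  rw [hf.map_mem_specIdeal, hf.map_mem_specIdeal]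
  exact p.2.2 _ _ hxy

end IsReticulation

/-- The element `⋁ {c ∈ K(A) : λ(c) ∈ I}` of the quantale that corresponds to an ideal `I` of its
reticulation. -/
def idealSup (f : K A → L) (I : Order.Ideal L) : A :=
  sSup {c | ∃ hc : IsCompactElement c, f ⟨c, hc⟩ ∈ I}

namespace IsReticulation

theorem le_idealSup_iff (hf : IsReticulation f) {I : Order.Ideal L} {c : K A} :
    c.1 ≤ idealSup f I ↔ f c ∈ I := by
  refine ⟨fun h => ?_, fun h => le_sSup ⟨c.2, h⟩⟩
  obtain ⟨d, ⟨hd, hdI⟩, hcd⟩ := c.2 {c | ∃ hc : IsCompactElement c, f ⟨c, hc⟩ ∈ I} _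
    ⟨⊥, isCompact_bot, hf.map_bot ▸ I.bot_mem⟩
    (by
      rintro a ⟨ha, haI⟩ b ⟨hb, hbI⟩
      have hab : f (K.sup ⟨a, ha⟩ ⟨b, hb⟩) ∈ I := hf.map_sup _ _ ▸ I.sup_mem haI hbI
      exact ⟨a ⊔ b, ⟨isCompact_sup ha hb, hab⟩, le_sup_left, le_sup_right⟩)
    (isLUB_sSup _) h
  exact I.lower (hf.map_le_map_of_le (b := ⟨d, hd⟩) hcd) hdI

theorem isMPrime_idealSup (hf : IsReticulation f) {I : Order.Ideal L} (hI : I.IsPrime) :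
    IsMPrime (idealSup f I) := by
  refine ⟨lt_top_iff_ne_top.2 fun h => ?_, fun a b hab => ?_⟩
  · have htop : (⊤ : L) ∈ I := hf.map_top ▸ hf.le_idealSup_iff.1 h.ge
    exact hI.toIsProper.ne_univ (Set.eq_univ_of_forall fun _ => I.lower le_top htop)
  · by_contra! h
    obtain ⟨c, hc, hca, hcI⟩ := exists_isCompactElement_le_not_le h.1
    obtain ⟨d, hd, hdb, hdI⟩ := exists_isCompactElement_le_not_le h.2
    have hcd : f ⟨c, hc⟩ ⊓ f ⟨d, hd⟩ ∈ I :=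
      hf.map_mul ⟨c, hc⟩ ⟨d, hd⟩ ▸ hf.le_idealSup_iff.1 ((mul_le_mul' hca hdb).trans hab)
    rcases hI.mem_or_mem hcd with hcI' | hdI'
    · exact hcI (hf.le_idealSup_iff.2 hcI')
    · exact hdI (hf.le_idealSup_iff.2 hdI')

/-- The homeomorphism between the spectrum of a coherent quantale and the prime spectrum of its
reticulation. -/
def specHomeomorph (hf : IsReticulation f) : SpecZ A ≃ₜ SpecIdZ L where
  toFun p := ⟨hf.specIdeal p, hf.isPrime_specIdeal p⟩
  invFun I := ⟨idealSup f I.1, hf.isMPrime_idealSup I.2⟩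
  left_inv p := Subtype.ext <| by
    have h : ∀ c : K A, c.1 ≤ idealSup f (hf.specIdeal p) ↔ c.1 ≤ p.1 := fun _ =>
      hf.le_idealSup_iff.trans hf.map_mem_specIdeal
    exact le_antisymm (le_iff_compact_le_imp.2 fun c hc => (h ⟨c, hc⟩).1)
      (le_iff_compact_le_imp.2 fun c hc => (h ⟨c, hc⟩).2)
  right_inv I := Subtype.ext <| SetLike.ext fun x => by
    obtain ⟨c, rfl⟩ := hf.surjective x
    exact hf.map_mem_specIdeal.trans hf.le_idealSup_iff
  continuous_toFun := by
    refine continuous_generateFrom_iff.2 ?_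
    rintro _ ⟨x, rfl⟩
    obtain ⟨c, rfl⟩ := hf.surjective x
    convert (isClosed_specZ_le c.1).isOpen_compl using 1
    exact Set.ext fun p => not_congr hf.map_mem_specIdeal
  continuous_invFun := by
    refine continuous_specZ_iff.2 fun c hc => ⟨.basic _ ⟨f ⟨c, hc⟩, ?_⟩⟩
    exact Set.ext fun I => not_congr (hf.le_idealSup_iff (c := ⟨c, hc⟩))

theorem specHomeomorph_le_iff (hf : IsReticulation f) {p q : SpecZ A} :
    (hf.specHomeomorph p).1 ≤ (hf.specHomeomorph q).1 ↔ p.1 ≤ q.1 := by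
  refine ⟨fun h => le_iff_compact_le_imp.2 fun c hc hcp => ?_, fun h x hx => ?_⟩
  · exact hf.map_mem_specIdeal.1 (h (hf.map_mem_specIdeal (c := ⟨c, hc⟩).2 hcp))
  · obtain ⟨c, rfl⟩ := hf.surjective x
    exact hf.map_mem_specIdeal.2 ((hf.map_mem_specIdeal.1 hx).trans h)

theorem isMinimalMPrime_iff_minimal_specHomeomorph (hf : IsReticulation f) (p : SpecZ A) :
    IsMinimalMPrime p.1 ↔ Minimal (fun I : Order.Ideal L => I.IsPrime) (hf.specHomeomorph p).1 := by
  constructor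
  · refine fun h => ⟨(hf.specHomeomorph p).2, fun I hI hle => ?_⟩
    obtain ⟨q, hq⟩ := hf.specHomeomorph.surjective (⟨I, hI⟩ : SpecIdZ L)
    obtain rfl : (hf.specHomeomorph q).1 = I := congrArg Subtype.val hq
    exact hf.specHomeomorph_le_iff.2 (h.2 q.2 (hf.specHomeomorph_le_iff.1 hle))
  · exact fun h => ⟨p.2, fun q hq hle => (hf.specHomeomorph_le_iff (q := ⟨q, hq⟩)).1
      (h.2 (hf.specHomeomorph ⟨q, hq⟩).2 ((hf.specHomeomorph_le_iff (p := ⟨q, hq⟩)).2 hle))⟩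

theorem compactSpace_minIdZ_iff (hf : IsReticulation f) :
    CompactSpace (MinIdZ L) ↔ CompactSpace (MinZ A) := by
  have e : MinZ A ≃ₜ MinIdZ L :=
    hf.specHomeomorph.subtype hf.isMinimalMPrime_iff_minimal_specHomeomorph
  exact ⟨fun _ => e.symm.compactSpace, fun _ => e.compactSpace⟩

end IsReticulation

end Reticulation

end CohQuantale

theorem theorem8p5_general {A : Type u} [CommMonoid A] [CompleteLattice A] [IsQuantale A]
    [CohQuantale.IsCoherent A] (hA : CohQuantale.IsSemiprime A)
    {L : Type v} [DistribLattice L] [BoundedOrder L] {f : CohQuantale.K A → L}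
    (hf : CohQuantale.IsReticulation f) :
    List.TFAE
      [CohQuantale.IsPP A,
        CohQuantale.IsStoneLattice L,
        CohQuantale.IsConormalLattice L ∧ CompactSpace (CohQuantale.MinIdZ L),
        CohQuantale.IsPF A ∧ CompactSpace (CohQuantale.MinZ A),
        CohQuantale.IsPF A ∧ CohQuantale.IsBooleanSpace (CohQuantale.MinZ A),
        CohQuantale.IsMP A ∧ CohQuantale.IsBooleanSpace (CohQuantale.MinZ A),
        NormalSpace (CohQuantale.SpecF A) ∧
          CohQuantale.IsBooleanSpace (CohQuantale.MinZ A)] := by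
  tfae_have 1 ↔ 2 := (hf.isStoneLattice_iff hA).symm
  tfae_have 3 ↔ 4 := and_congr (hf.isConormalLattice_iff hA) hf.compactSpace_minIdZ_iff
  tfae_have 4 ↔ 5 := and_congr_right' hA.isBooleanSpace_minZ_iff.symm
  tfae_have 1 → 4 := fun h => ⟨h.isPF, h.compactSpace_minZ⟩
  tfae_have 4 → 1 := fun ⟨h, _⟩ => h.isPP
  tfae_have 5 ↔ 6 := and_congr_left' ⟨fun h => h.isMP, fun h => h.isPF hA⟩
  tfae_have 1 → 7 := fun h =>
    ⟨h.normalSpace_specF, hA.isBooleanSpace_minZ_iff.2 h.compactSpace_minZ⟩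
  tfae_have 7 → 6 := fun ⟨_, h⟩ => ⟨CohQuantale.isMP_of_normalSpace_specF, h⟩
  tfae_finish

theorem theorem8p5 {A : Type u} [CommMonoid A] [CompleteLattice A] [IsQuantale A]
    [CohQuantale.IsCoherent A] (hA : CohQuantale.IsSemiprime A) :
    List.TFAE
      [CohQuantale.IsPP A,
        CohQuantale.IsStoneLattice (CohQuantale.Retic A),
        CohQuantale.IsConormalLattice (CohQuantale.Retic A) ∧
          CompactSpace (CohQuantale.MinIdZ (CohQuantale.Retic A)),
        CohQuantale.IsPF A ∧ CompactSpace (CohQuantale.MinZ A),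
        CohQuantale.IsPF A ∧ CohQuantale.IsBooleanSpace (CohQuantale.MinZ A),
        CohQuantale.IsMP A ∧ CohQuantale.IsBooleanSpace (CohQuantale.MinZ A),
        NormalSpace (CohQuantale.SpecF A) ∧
          CohQuantale.IsBooleanSpace (CohQuantale.MinZ A)] :=
  theorem8p5_general hA CohQuantale.isReticulation_lam
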